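/- Let $G$ be a finite simple graph with vertex set $V$ (the servers $S_i$, $i\in V$) and edge set $E$. Every edge $e$ corresponds to a file $W_e$, stored exactly on the two endpoints of $e$; the files are independent, and each is uniform on $\mathbb F_q^L$ for a finite field $\mathbb F_q$ and an integer $L\ge 1$. Write $\mathcal W_{S_i}$ for the collection of files stored on $S_i$. All entropies are taken in base $q$, so $H(W_e)=L$. A PIR scheme on $G$ specifies, besides $q$ and $L$, for every $\theta\in E$ a (jointly distributed, discrete) tuple of queries $(Q_i^{[\theta]})_{i\in V}$ independent of the files, and for every server $S_i$ a function giving its answer $A_i^{[\theta]}$ from $Q_i^{[\theta]}$ and $\mathcal W_{S_i}$. It is valid if it satisfies * reliability: $H\bigl(W_\theta \mid (A_i^{[\theta]})_{i\in V},(Q_i^{[\theta]})_{i\in V}\bigr)=0$ for every $\theta\in E$; * privacy: for every $i\in V$, the joint distribution of $(Q_i^{[\theta]},A_i^{[\theta]},\mathcal W_{S_i})$ does not depend on $\theta\in E$. The retrieval rate of a valid scheme is $L/\sum_{i\in V}H(A_i^{[\theta]})$ (which does not depend on $\theta$), and the PIR capacity $\mathcal C(G)$ is the supremum of the rates of all valid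 PIR schemes on $G$. Let $\mathcal C'(G)$ be the analogous supremum for the rates $L/\sum_{i\in V}H(A_i^{[\theta]}\mid Q_i^{[\theta]})$. **Theorem.** Let $K_N$ be the complete graph on $N$ vertices. For every integer $N\ge 3$, $$\mathcal C(K_N)\le b_N \quad\text{and}\quad \mathcal C'(K_N)\le b_N,\qquad\text{where } b_N:=\frac{1}{\sum_{i=2}^{N}\frac1{i!}}\cdot\frac1N .$$ Consequently $\mathcal C(K_N)<\frac{2}{N+1}$ for every $N\ge 4$, so that the upper bound $\frac{2}{N+1}$, conjectured to be tight by Sadeh, Gu and Tamo, is not tight. Moreover $\lim_{N\to\infty}N\,b_N=\frac1{e-2}$, hence $\limsup_{N\to\infty}N\,\mathcal C(K_N)\le\frac1{e-2}$, where $\bigl|\frac{1}{e-2}-1.3922\bigr|<5\cdot 10^{-5}$. -/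

import Mathlib

open scoped ENNReal Nat

/-- Shannon entropy, in base `b`, of a discrete distribution `p`:
`H(p) = ∑ₐ -p(a) log_b p(a)`, an element of `[0, ∞]` (for `b > 1` every term is nonnegative). -/
noncomputable def entropy {α : Type*} (b : ℝ) (p : PMF α) : ℝ≥0∞ :=
  ∑' a, ENNReal.ofReal (-((p a).toReal * Real.logb b (p a).toReal))

/-- Conditional Shannon entropy `H(X ∣ Y)`, in base `b`, of a pair `(X, Y)` with joint
distribution `p`: `H(X ∣ Y) = ∑ₓ,ᵧ -p(x, y) log_b (p(x, y) / p_Y(y))`, an element of `[0, ∞]`. -/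
noncomputable def condEntropy {α β : Type*} (b : ℝ) (p : PMF (α × β)) : ℝ≥0∞ :=
  ∑' z : α × β, ENNReal.ofReal
    (-((p z).toReal * Real.logb b ((p z).toReal / (p.map Prod.snd z.2).toReal)))

/-- The data of a PIR scheme on the graph-based storage system of `G`: the vertices are the
servers, and every edge `e` is a file stored on exactly the two endpoints of `e`. A file consists of
`L ≥ 1` symbols of a finite field `F`. When the user wants the file `θ`, the user draws the whole
tuple of queries (one for each server, possibly dependent on each other) from the
distribution `query θ`; the server `i` answers by a function of the query it receives
and of the files that it stores. -/
structure PIRScheme {V : Type*} (G : SimpleGraph V) where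
  /-- the field of symbols -/
  F : Type
  [field : Field F]
  [fintype : Fintype F]
  /-- the number of symbols (sub-files) of each file -/
  L : ℕ
  L_pos : 0 < L
  /-- the query alphabet of each server -/
  Query : V → Type
  /-- the answer alphabet of each server -/
  Answer : V → Type
  /-- the joint distribution of all queries, for a desired file -/
  query : G.edgeSet → PMF (∀ i, Query i)
  /-- the answer of server `i` to a query, given the contents of the files stored on `i` -/
  answer : ∀ i, Query i → ({e : G.edgeSet // i ∈ (e : Sym2 V)} → Fin L → F) → Answer i

namespace PIRScheme

attribute [instance] PIRScheme.field PIRScheme.fintype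

variable {V : Type*} [Finite V] {G : SimpleGraph V} (S : PIRScheme G)

/-- The contents of all files. -/
abbrev Files {V : Type*} {G : SimpleGraph V} (S : PIRScheme G) : Type _ :=
  G.edgeSet → Fin S.L → S.F

/-- The contents of the files stored on server `i`. -/
abbrev LocalFiles {V : Type*} {G : SimpleGraph V} (S : PIRScheme G) (i : V) : Type _ :=
  {e : G.edgeSet // i ∈ (e : Sym2 V)} → Fin S.L → S.F

/-- A realisation of the scheme: all the queries, and the contents of all the files. -/
abbrev Outcome {V : Type*} {G : SimpleGraph V} (S : PIRScheme G) : Type _ :=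
  (∀ i, S.Query i) × S.Files

/-- The contents of the files are independent and uniform: every file has entropy `L` in base
`|F|`. -/
noncomputable def filesLaw : PMF S.Files :=
  haveI : Fintype S.Files := Fintype.ofFinite _
  PMF.uniformOfFintype S.Files

/-- The joint law of queries and files when the desired file is `θ`: the queries have law
`query θ` and are independent of the files. -/
noncomputable def law (θ : G.edgeSet) : PMF S.Outcome :=
  (S.query θ).bind fun q => S.filesLaw.map fun w => (q, w)

/-- The contents of the files stored on server `i`, as a random variable. -/
def localFiles {V : Type*} {G : SimpleGraph V} (S : PIRScheme G) (i : V) (ω : S.Outcome) :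
    S.LocalFiles i :=
  fun e => ω.2 e.1

/-- The answer `A_i` of server `i`, as a random variable. -/
def ans {V : Type*} {G : SimpleGraph V} (S : PIRScheme G) (i : V) (ω : S.Outcome) : S.Answer i :=
  S.answer i (ω.1 i) (S.localFiles i ω)

/-- Entropies are measured in symbols of `F` (dits), that is, in base `|F|`. -/
noncomputable def base {V : Type*} {G : SimpleGraph V} (S : PIRScheme G) : ℝ := Fintype.card S.F

/-- Reliability: the answers and the queries determine the desired file,
`H(W_θ ∣ A_1, …, A_N, Q_1, …, Q_N) = 0` for every `θ`. -/
def IsReliable : Prop :=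
  ∀ θ : G.edgeSet,
    condEntropy S.base ((S.law θ).map fun ω => (ω.2 θ, ((fun i => S.ans i ω), ω.1))) = 0

/-- Privacy: for every server `i`, the joint law of its query, its answer and the files stored on
it is the same for all desired files. -/
def IsPrivate : Prop :=
  ∀ (i : V) (θ θ' : G.edgeSet),
    (S.law θ).map (fun ω => (ω.1 i, S.ans i ω, S.localFiles i ω)) =
      (S.law θ').map (fun ω => (ω.1 i, S.ans i ω, S.localFiles i ω))

/-- A valid PIR scheme. -/
def IsValid : Prop := S.IsReliable ∧ S.IsPrivate

/-- The retrieval rate `L / ∑ᵢ H(A_i)`, where the answers are those for the desired file `θ`. For a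
valid scheme it does not depend on `θ`, see `IsValid.rate_eq`. -/
noncomputable def rate (θ : G.edgeSet) : ℝ≥0∞ :=
  (S.L : ℝ≥0∞) / ∑' i, entropy S.base ((S.law θ).map (S.ans i))

/-- The retrieval rate `L / ∑ᵢ H(A_i ∣ Q_i)` with the entropies conditioned on the queries. For a
valid scheme it does not depend on `θ`, see `IsValid.condRate_eq`. -/
noncomputable def condRate (θ : G.edgeSet) : ℝ≥0∞ :=
  (S.L : ℝ≥0∞) /
    ∑' i, condEntropy S.base ((S.law θ).map fun ω => (S.ans i ω, ω.1 i))

theorem IsValid.rate_eq {S : PIRScheme G} (h : S.IsValid) (θ θ' : G.edgeSet) :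
    S.rate θ = S.rate θ' := by
  have key : ∀ i, (S.law θ).map (S.ans i) = (S.law θ').map (S.ans i) := fun i => by
    have := congrArg (PMF.map fun x => x.2.1) (h.2 i θ θ')
    simpa only [PMF.map_comp, Function.comp_def] using this
  simp only [rate, key]

theorem IsValid.condRate_eq {S : PIRScheme G} (h : S.IsValid) (θ θ' : G.edgeSet) :
    S.condRate θ = S.condRate θ' := by
  have key : ∀ i, (S.law θ).map (fun ω => (S.ans i ω, ω.1 i)) =
      (S.law θ').map (fun ω => (S.ans i ω, ω.1 i)) := fun i => by
    have := congrArg (PMF.map fun x => (x.2.1, x.1)) (h.2 i θ θ')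
    simpa only [PMF.map_comp, Function.comp_def] using this
  simp only [condRate, key]

end PIRScheme

/-- The PIR capacity of a graph: the supremum, in `[0, ∞]`, of the rates `L / ∑ᵢ H(A_i)` of all
valid PIR schemes. -/
noncomputable def pirCapacity {V : Type*} [Finite V] (G : SimpleGraph V) : ℝ≥0∞ :=
  ⨆ (S : PIRScheme G) (_ : S.IsValid) (θ : G.edgeSet), S.rate θ

/-- The PIR capacity of a graph with respect to the rates `L / ∑ᵢ H(A_i ∣ Q_i)`. -/
noncomputable def pirCondCapacity {V : Type*} [Finite V] (G : SimpleGraph V) : ℝ≥0∞ :=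
  ⨆ (S : PIRScheme G) (_ : S.IsValid) (θ : G.edgeSet), S.condRate θ

/-- The number `1 / ((∑_{i=2}^N 1/i!) N)`. -/
noncomputable def pirBound (N : ℕ) : ℝ :=
  1 / ((∑ i ∈ Finset.Icc 2 N, 1 / (i ! : ℝ)) * N)

/-! For a set U of servers and i ∈ U, let X(U, i) be the entropy of the answer of i given its query
and all files not stored inside U. Answers are functions of queries and files, so X depends on the
scheme only through the law of the single query of i; by privacy X does not depend on the desired
file. Order the servers as σ 0, …, σ (N-1), put U = {σ 0, …, σ j}, a = σ j, c = σ (j-1), and let θ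
be the edge ac. Given the files outside U, the answers from U determine W_θ. Hence the sum of X(U,
i) over i ∈ U is at least L plus the joint entropy of these answers given W_θ and the files outside
U. Split this entropy into that of A_a and that of the rest given A_a. Conditioning the first on all
files outside U \ {c} leaves at least X(U \ {c}, a). Conditioning the second on all files outside U
\ {a}, which determine A_a, and then removing servers one at a time leaves at least ∑_{i<j} X({σ 0,
…, σ i}, σ i). This is `add_partitionCondEntropy_le_sum` together with
`sum_partitionCondEntropy_le`. Every pair is an edge of the complete graph, so this holds for all
orderings. Summing over σ, with y_j the sum of X({σ 0, …, σ j}, σ j), gives N!·L + y_{j-1} + ∑_{i<j}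
y_i ≤ (j+1) y_j. The recursion with equality is solved by N!·L·∑_{i=2}^{j+1} 1/i!, and its last term
bounds the total download (`factSum_mul_le_sum`). For fixed queries everything is a function of
uniform files, so the entropy calculus is carried out for partitions of a finite set and averaged
over the queries afterwards. -/

/-! ### Entropy of partitions of a finite uniform space (a finer partition is smaller and carries
more information; `⊓` is the joint variable) -/

section PartitionEntropy

variable {Ω : Type*} [Fintype Ω]

open scoped Classical in
/-- The number of points in the class of `ω`. -/
noncomputable def cellCard (s : Setoid Ω) (ω : Ω) : ℕ :=
  (Finset.univ.filter fun ω' => s ω ω').card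

theorem cellCard_pos (s : Setoid Ω) (ω : Ω) : 0 < cellCard s ω := by
  classical
  exact Finset.card_pos.2 ⟨ω, by simp⟩

theorem cellCard_mono {s t : Setoid Ω} (h : s ≤ t) (ω : Ω) : cellCard s ω ≤ cellCard t ω := by
  classical
  exact Finset.card_le_card fun x hx => by
    simp only [Finset.mem_filter, Finset.mem_univ, true_and] at hx ⊢
    exact h hx

theorem cellCard_congr {s : Setoid Ω} {ω ω' : Ω} (h : s ω ω') : cellCard s ω = cellCard s ω' := by
  classical
  unfold cellCard
  congr 1
  ext x
  simp only [Finset.mem_filter, Finset.mem_univ, true_and]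
  exact ⟨fun hx => s.trans (s.symm h) hx, fun hx => s.trans h hx⟩

/-- The entropy, in base `b`, of the class of a uniform random point of `Ω`. -/
noncomputable def partitionEntropy (b : ℝ) (s : Setoid Ω) : ℝ :=
  (∑ ω, (Real.logb b (Fintype.card Ω) - Real.logb b (cellCard s ω))) / Fintype.card Ω

theorem partitionEntropy_anti {b : ℝ} (hb : 1 < b) {s t : Setoid Ω} (h : s ≤ t) :
    partitionEntropy b t ≤ partitionEntropy b s := by
  unfold partitionEntropy
  gcongr with ω
  · exact_mod_cast cellCard_pos s ω
  · exact cellCard_mono h ω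

/-- The numerator counts pairs (ω₁, ω₂) with ω₁ in the `s ⊓ r` class and ω₂ in the `t ⊓ r` class of
ω. After exchanging sums, each pair (ω₁, ω₂) in a common `r` class contributes at most 1 / |r
class|, and there are |r class| such ω₂ for each ω₁. -/
theorem sum_cellCard_ratio_le (s t r : Setoid Ω) :
    ∑ ω, ((cellCard (s ⊓ r) ω : ℝ) * cellCard (t ⊓ r) ω) /
      (cellCard (s ⊓ t ⊓ r) ω * cellCard r ω) ≤ Fintype.card Ω := by
  classical
  have key : ∀ ω₁ ω₂ : Ω, (∑ ω, if (s ⊓ r) ω ω₁ ∧ (t ⊓ r) ω ω₂ then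
      1 / ((cellCard (s ⊓ t ⊓ r) ω : ℝ) * cellCard r ω) else 0) ≤
      if r ω₁ ω₂ then 1 / (cellCard r ω₁ : ℝ) else 0 := by
    intro ω₁ ω₂
    by_cases hex : ∃ ω₀, (s ⊓ r) ω₀ ω₁ ∧ (t ⊓ r) ω₀ ω₂
    · obtain ⟨ω₀, ⟨h1, h2⟩, h3, h4⟩ := hex
      rw [if_pos (r.trans (r.symm h2) h4), ← Finset.sum_filter]
      -- The points compatible with a given pair, if there are any, form exactly one class of `s ⊓ t
      -- ⊓ r`, whose size cancels in the weight.
      have hset : (Finset.univ.filter fun ω => (s ⊓ r) ω ω₁ ∧ (t ⊓ r) ω ω₂) =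
          Finset.univ.filter fun ω => (s ⊓ t ⊓ r) ω₀ ω := by
        ext ω
        simp only [Finset.mem_filter, Finset.mem_univ, true_and]
        constructor
        · rintro ⟨⟨a1, a2⟩, a3, _⟩
          exact ⟨⟨s.trans h1 (s.symm a1), t.trans h3 (t.symm a3)⟩, r.trans h2 (r.symm a2)⟩
        · rintro ⟨⟨a1, a2⟩, a3⟩
          exact ⟨⟨s.trans (s.symm a1) h1, r.trans (r.symm a3) h2⟩,
            t.trans (t.symm a2) h3, r.trans (r.symm a3) h4⟩
      rw [hset]
      have hconst : ∀ ω ∈ Finset.univ.filter (fun ω => (s ⊓ t ⊓ r) ω₀ ω),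
          1 / ((cellCard (s ⊓ t ⊓ r) ω : ℝ) * cellCard r ω) =
          1 / ((cellCard (s ⊓ t ⊓ r) ω₀ : ℝ) * cellCard r ω₁) := by
        intro ω hω
        simp only [Finset.mem_filter, Finset.mem_univ, true_and] at hω
        rw [← cellCard_congr hω, ← cellCard_congr hω.2, cellCard_congr h2]
      rw [Finset.sum_congr rfl hconst, Finset.sum_const, nsmul_eq_mul]
      have h5 : ((Finset.univ.filter fun ω => (s ⊓ t ⊓ r) ω₀ ω).card : ℝ) =
        cellCard (s ⊓ t ⊓ r) ω₀ := rfl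
      rw [h5]
      have h6 : (cellCard (s ⊓ t ⊓ r) ω₀ : ℝ) ≠ 0 := by exact_mod_cast (cellCard_pos _ _).ne'
      have h7 : (cellCard r ω₁ : ℝ) ≠ 0 := by exact_mod_cast (cellCard_pos _ _).ne'
      apply le_of_eq
      field_simp
    · push Not at hex
      rw [Finset.sum_eq_zero]
      · split_ifs <;> positivity
      · intro ω _
        rw [if_neg]
        rintro ⟨h1, h2⟩
        exact hex ω h1 h2
  have cell_sum : ∀ (u : Setoid Ω) (ω : Ω), (cellCard u ω : ℝ) = ∑ ω', if u ω ω' then 1 else 0 := by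
    intro u ω
    simp [cellCard]
  calc _ = ∑ ω, ∑ ω₁, ∑ ω₂, (if (s ⊓ r) ω ω₁ ∧ (t ⊓ r) ω ω₂ then
      1 / ((cellCard (s ⊓ t ⊓ r) ω : ℝ) * cellCard r ω) else 0) := by
        refine Finset.sum_congr rfl fun ω _ => ?_
        rw [cell_sum (s ⊓ r), cell_sum (t ⊓ r), Finset.sum_mul_sum, Finset.sum_div]
        refine Finset.sum_congr rfl fun ω₁ _ => ?_
        rw [Finset.sum_div]
        refine Finset.sum_congr rfl fun ω₂ _ => ?_
        by_cases h1 : (s ⊓ r) ω ω₁ <;> by_cases h2 : (t ⊓ r) ω ω₂ <;> simp [h1, h2]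
    _ = ∑ ω₁, ∑ ω₂, ∑ ω, (if (s ⊓ r) ω ω₁ ∧ (t ⊓ r) ω ω₂ then
      1 / ((cellCard (s ⊓ t ⊓ r) ω : ℝ) * cellCard r ω) else 0) := by
        rw [Finset.sum_comm]
        exact Finset.sum_congr rfl fun ω₁ _ => Finset.sum_comm
    _ ≤ ∑ ω₁, ∑ ω₂, (if r ω₁ ω₂ then 1 / (cellCard r ω₁ : ℝ) else 0) :=
        Finset.sum_le_sum fun ω₁ _ => Finset.sum_le_sum fun ω₂ _ => key ω₁ ω₂
    _ = ∑ _ω₁ : Ω, (1 : ℝ) := by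
        refine Finset.sum_congr rfl fun ω₁ _ => ?_
        have h7 : (cellCard r ω₁ : ℝ) ≠ 0 := by exact_mod_cast (cellCard_pos _ _).ne'
        rw [← Finset.sum_filter, Finset.sum_const, nsmul_eq_mul]
        exact mul_one_div_cancel h7
    _ = _ := by simp

/-- Nonnegativity of conditional mutual information: log x ≤ x - 1 is applied to the ratio of class
sizes, whose mean is at most 1. -/
theorem partitionEntropy_submodular {b : ℝ} (hb : 1 < b) (s t r : Setoid Ω) :
    partitionEntropy b (s ⊓ t ⊓ r) + partitionEntropy b r ≤
      partitionEntropy b (s ⊓ r) + partitionEntropy b (t ⊓ r) := by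
  have hlog : 0 < Real.log b := Real.log_pos hb
  have h0 : ∑ ω, (Real.logb b (cellCard (s ⊓ r) ω) + Real.logb b (cellCard (t ⊓ r) ω) -
      Real.logb b (cellCard (s ⊓ t ⊓ r) ω) - Real.logb b (cellCard r ω)) ≤ 0 := by
    calc _ ≤ ∑ ω, (((cellCard (s ⊓ r) ω : ℝ) * cellCard (t ⊓ r) ω) /
          (cellCard (s ⊓ t ⊓ r) ω * cellCard r ω) - 1) / Real.log b := by
          refine Finset.sum_le_sum fun ω _ => ?_
          have p1 : (0 : ℝ) < cellCard (s ⊓ r) ω := by exact_mod_cast cellCard_pos _ _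
          have p2 : (0 : ℝ) < cellCard (t ⊓ r) ω := by exact_mod_cast cellCard_pos _ _
          have p3 : (0 : ℝ) < cellCard (s ⊓ t ⊓ r) ω := by exact_mod_cast cellCard_pos _ _
          have p4 : (0 : ℝ) < cellCard r ω := by exact_mod_cast cellCard_pos _ _
          have := Real.log_le_sub_one_of_pos
            (x := ((cellCard (s ⊓ r) ω : ℝ) * cellCard (t ⊓ r) ω) /
              (cellCard (s ⊓ t ⊓ r) ω * cellCard r ω)) (by positivity)
          rw [Real.log_div (by positivity) (by positivity), Real.log_mul p1.ne' p2.ne',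
            Real.log_mul p3.ne' p4.ne'] at this
          simp only [Real.logb, ← add_div, ← sub_div]
          rw [div_le_div_iff_of_pos_right hlog]
          linarith
      _ ≤ 0 := by
          rw [← Finset.sum_div, Finset.sum_sub_distrib]
          apply div_nonpos_of_nonpos_of_nonneg _ hlog.le
          have := sum_cellCard_ratio_le s t r
          simp
          linarith
  unfold partitionEntropy
  rw [← add_div, ← add_div]
  refine div_le_div_of_nonneg_right ?_ (Nat.cast_nonneg _)
  simp only [Finset.sum_add_distrib, Finset.sum_sub_distrib] at h0 ⊢
  linarith

/-- The conditional entropy, in base `b`, of the class under `s` given the class under `r`. -/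
noncomputable def partitionCondEntropy (b : ℝ) (s r : Setoid Ω) : ℝ :=
  partitionEntropy b (s ⊓ r) - partitionEntropy b r

theorem partitionCondEntropy_nonneg {b : ℝ} (hb : 1 < b) (s r : Setoid Ω) :
    0 ≤ partitionCondEntropy b s r :=
  sub_nonneg.2 (partitionEntropy_anti hb inf_le_right)

theorem partitionCondEntropy_anti_right {b : ℝ} (hb : 1 < b) (s : Setoid Ω) {r r' : Setoid Ω}
    (h : r' ≤ r) : partitionCondEntropy b s r' ≤ partitionCondEntropy b s r := by
  have := partitionEntropy_submodular hb s r' r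
  rw [inf_assoc, inf_eq_left.2 h] at this
  unfold partitionCondEntropy
  linarith

theorem partitionCondEntropy_chain (b : ℝ) (s t r : Setoid Ω) :
    partitionCondEntropy b (s ⊓ t) r =
      partitionCondEntropy b s r + partitionCondEntropy b t (s ⊓ r) := by
  unfold partitionCondEntropy
  rw [← inf_assoc, inf_comm t s]
  ring

theorem partitionEntropy_top (b : ℝ) : partitionEntropy b (⊤ : Setoid Ω) = 0 := by
  have : ∀ ω : Ω, cellCard (⊤ : Setoid Ω) ω = Fintype.card Ω := fun ω => by
    simp [cellCard]
  simp [partitionEntropy, this]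

theorem partitionCondEntropy_finset_inf_le {b : ℝ} (hb : 1 < b) {ι : Type*} (U : Finset ι)
    (s : ι → Setoid Ω) (r : Setoid Ω) :
    partitionCondEntropy b (U.inf s) r ≤ ∑ i ∈ U, partitionCondEntropy b (s i) r := by
  classical
  induction U using Finset.induction_on with
  | empty => simp [partitionCondEntropy]
  | insert a U ha ih =>
    rw [Finset.inf_insert, Finset.sum_insert ha, partitionCondEntropy_chain]
    have := partitionCondEntropy_anti_right hb (U.inf s) (inf_le_right : s a ⊓ r ≤ r)
    linarith

end PartitionEntropy

/-! ### Partitions of the file space by subsets of files -/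

/-- Two functions are related if they agree on `T`. -/
def agreeOn {ι α : Type*} (T : Set ι) : Setoid (ι → α) where
  r w w' := ∀ e ∈ T, w e = w' e
  iseqv := ⟨fun _ _ _ => rfl, fun h e he => (h e he).symm,
    fun h h' e he => (h e he).trans (h' e he)⟩

theorem agreeOn_anti {ι α : Type*} {T T' : Set ι} (h : T ⊆ T') :
    (agreeOn T' : Setoid (ι → α)) ≤ agreeOn T :=
  fun {_ _} hw e he => hw e (h he)

theorem agreeOn_empty {ι α : Type*} : (agreeOn ∅ : Setoid (ι → α)) = ⊤ := by
  ext w w'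
  exact ⟨fun _ => trivial, fun _ e he => he.elim⟩

/-- Overwriting the coordinate e ∉ T by an arbitrary value stays in the `T` class, and does so
injectively when the old value at e is prescribed. -/
theorem card_mul_cellCard_le {ι α : Type*} [Fintype (ι → α)] [Fintype α] {T : Set ι} {e : ι}
    (he : e ∉ T) (w : ι → α) :
    Fintype.card α * cellCard (agreeOn {e} ⊓ agreeOn T) w ≤ cellCard (agreeOn T) w := by
  classical
  unfold cellCard
  rw [← Finset.card_univ, ← Finset.card_product]
  refine Finset.card_le_card_of_injOn (fun x => Function.update x.2 e x.1) ?_ ?_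
  · intro x hx
    simp only [Finset.coe_product, Finset.coe_univ, Finset.coe_filter, Finset.mem_univ,
      true_and, Set.mem_prod, Set.mem_univ, Set.mem_ofPred_eq] at hx ⊢
    intro e' he'
    rw [Function.update_of_ne (by rintro rfl; exact he he')]
    exact hx.2 e' he'
  · rintro ⟨a, x⟩ hx ⟨a', x'⟩ hx' h
    simp only [Finset.coe_product, Finset.coe_univ, Finset.coe_filter, Finset.mem_univ,
      true_and, Set.mem_prod, Set.mem_univ, Set.mem_ofPred_eq] at hx hx' h
    have h1 : a = a' := by simpa using congrFun h e
    refine Prod.ext h1 (funext fun e' => ?_)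
    by_cases hee : e' = e
    · subst hee
      exact (hx.1 _ rfl).symm.trans (hx'.1 _ rfl)
    · simpa [Function.update_of_ne hee] using congrFun h e'

/-- A file outside T keeps its full entropy when the files in T are known. Only this direction is
needed, as it supplies the term L in the main inequality. -/
theorem logb_card_le_partitionCondEntropy {ι α : Type*} [Fintype (ι → α)] [Fintype α] [Nonempty α]
    {b : ℝ} (hb : 1 < b) {T : Set ι} {e : ι} (he : e ∉ T) :
    Real.logb b (Fintype.card α) ≤
      partitionCondEntropy b (agreeOn {e} : Setoid (ι → α)) (agreeOn T) := by
  have hΩ : (0 : ℝ) < Fintype.card (ι → α) := by exact_mod_cast Fintype.card_pos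
  unfold partitionCondEntropy partitionEntropy
  rw [← sub_div, le_div_iff₀ hΩ, ← Finset.sum_sub_distrib]
  calc Real.logb b (Fintype.card α) * Fintype.card (ι → α)
      = ∑ _w : ι → α, Real.logb b (Fintype.card α) := by simp [mul_comm]
    _ ≤ _ := by
      refine Finset.sum_le_sum fun w _ => ?_
      have h1 : (0 : ℝ) < cellCard (agreeOn {e} ⊓ agreeOn T) w := by
        exact_mod_cast cellCard_pos _ _
      have h2 : (0 : ℝ) < Fintype.card α := by exact_mod_cast Fintype.card_pos
      have h3 : (Fintype.card α : ℝ) * cellCard (agreeOn {e} ⊓ agreeOn T) w ≤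
          cellCard (agreeOn T) w := by exact_mod_cast card_mul_cellCard_le he w
      have h4 := Real.logb_le_logb_of_le hb (by positivity) h3
      rw [Real.logb_mul h2.ne' h1.ne'] at h4
      linarith

/-- The entropy of a function of a uniform random point is the entropy of its kernel. -/
theorem entropy_map_uniformOfFintype {Ω α : Type*} [Fintype Ω] [Nonempty Ω] {b : ℝ} (hb : 1 < b)
    (f : Ω → α) :
    entropy b ((PMF.uniformOfFintype Ω).map f) =
      ENNReal.ofReal (partitionEntropy b (Setoid.ker f)) := by
  classical
  have hΩ : (0 : ℝ) < Fintype.card Ω := by exact_mod_cast Fintype.card_pos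
  have hval : ∀ a, (((PMF.uniformOfFintype Ω).map f) a).toReal =
      ((Finset.univ.filter fun ω => f ω = a).card : ℝ) / Fintype.card Ω := by
    intro a
    rw [PMF.map_apply, tsum_fintype, ENNReal.toReal_sum]
    · simp only [PMF.uniformOfFintype_apply, apply_ite ENNReal.toReal, ENNReal.toReal_inv,
        ENNReal.toReal_natCast, ENNReal.toReal_zero, ← Finset.sum_filter, Finset.sum_const,
        nsmul_eq_mul, div_eq_mul_inv, eq_comm (a := a)]
    · intro ω _
      split_ifs
      · exact PMF.apply_ne_top _ _
      · simp
  have hcell : ∀ ω, cellCard (Setoid.ker f) ω = (Finset.univ.filter fun ω' => f ω' = f ω).card := by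
    intro ω
    unfold cellCard
    congr 1
    ext x
    simp [Setoid.ker_def, eq_comm]
  unfold entropy
  simp only [hval]
  rw [tsum_eq_sum (s := Finset.univ.image f), ← ENNReal.ofReal_sum_of_nonneg]
  · congr 1
    unfold partitionEntropy
    simp only [hcell]
    -- Grouping the points by their value under f turns the sum over points into a sum over values
    -- weighted by fibre size.
    rw [Finset.sum_comp (fun a => Real.logb b (Fintype.card Ω) -
      Real.logb b ((Finset.univ.filter fun ω' => f ω' = a).card)) f, Finset.sum_div]
    refine Finset.sum_congr rfl fun a ha => ?_
    obtain ⟨ω, -, rfl⟩ := Finset.mem_image.1 ha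
    have hpos : (0 : ℝ) < (Finset.univ.filter fun ω' => f ω' = f ω).card := by
      exact_mod_cast Finset.card_pos.2 ⟨ω, by simp⟩
    rw [Real.logb_div hpos.ne' hΩ.ne', nsmul_eq_mul]
    ring
  · intro a _
    rw [neg_nonneg]
    apply mul_nonpos_of_nonneg_of_nonpos (by positivity)
    apply Real.logb_nonpos hb (by positivity)
    rw [div_le_one hΩ]
    exact_mod_cast Finset.card_le_univ _
  · intro a ha
    have : (Finset.univ.filter fun ω => f ω = a) = ∅ := by
      ext ω
      simp only [Finset.mem_image, Finset.mem_univ, true_and, not_exists] at ha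
      simp [ha ω]
    simp [this]

/-! ### The factorial sums and the numerical form of the bound -/

/-- The partial sums `∑_{i=2}^m 1/i!`. -/
noncomputable def factSum (m : ℕ) : ℝ := ∑ i ∈ Finset.Icc 2 m, 1 / (i ! : ℝ)

theorem factSum_nonneg (m : ℕ) : 0 ≤ factSum m :=
  Finset.sum_nonneg fun _ _ => by positivity

theorem factSum_one : factSum 1 = 0 := by simp [factSum]

theorem factSum_succ {m : ℕ} (hm : 1 ≤ m) : factSum (m + 1) = factSum m + 1 / ((m + 1)! : ℝ) :=
  Finset.sum_Icc_succ_top (by omega) _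

theorem factSum_two : factSum 2 = 1 / 2 := by
  simp [factSum]

/-- The recursion for the averaged entropies, with equality. Subtracting consecutive instances says
that the increments d_m of the solution satisfy (m+2) d_{m+2} = d_{m+1}, which is where the
reciprocal factorials come from. -/
theorem succ_mul_factSum {m : ℕ} (hm : 1 ≤ m) :
    (m + 1) * factSum (m + 1) = 1 + factSum m + ∑ i ∈ Finset.range m, factSum (i + 1) := by
  induction m, hm using Nat.le_induction with
  | base => simp [factSum_one, factSum_two]; norm_num
  | succ m hm ih =>
    rw [Finset.sum_range_succ, factSum_succ (m := m + 1) (by omega)]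
    have h1 := factSum_succ hm
    have h2 : ((m + 1 + 1)! : ℝ) = (m + 2) * ((m + 1)! : ℝ) := by
      rw [Nat.factorial_succ (m + 1)]; push_cast; ring
    have h3 : ((m + 1)! : ℝ) ≠ 0 := by exact_mod_cast Nat.factorial_ne_zero _
    have h4 : ((m : ℝ) + 2) ≠ 0 := by positivity
    have h5 : ((m : ℝ) + 2) * (1 / ((m + 1 + 1)! : ℝ)) = 1 / ((m + 1)! : ℝ) := by
      rw [h2]; field_simp
    push_cast
    linear_combination ih + h5 - h1

theorem tendsto_factSum : Filter.Tendsto factSum Filter.atTop (nhds (Real.exp 1 - 2)) := by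
  have h : HasSum (fun n : ℕ => 1 / (n ! : ℝ)) (Real.exp 1) := by
    have := NormedSpace.expSeries_div_hasSum_exp (𝔸 := ℝ) 1
    rw [← Real.exp_eq_exp_ℝ] at this
    simpa using this
  have h1 := (h.tendsto_sum_nat.comp (Filter.tendsto_add_atTop_nat 1)).sub_const 2
  refine h1.congr' ?_
  filter_upwards [Filter.eventually_ge_atTop 1] with n hn
  simp only [Function.comp_apply]
  induction n, hn using Nat.le_induction with
  | base => simp [factSum_one, Finset.sum_range_succ]; norm_num
  | succ m hm ih =>
    rw [Finset.sum_range_succ, factSum_succ hm, ← ih]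
    ring

theorem pirBound_eq (N : ℕ) : pirBound N = 1 / (factSum N * N) := rfl

theorem factSum_mono {m n : ℕ} (h : m ≤ n) : factSum m ≤ factSum n :=
  Finset.sum_le_sum_of_subset_of_nonneg (Finset.Icc_subset_Icc_right h) fun _ _ _ => by positivity

theorem factSum_pos {m : ℕ} (hm : 2 ≤ m) : 0 < factSum m := by
  have := factSum_mono hm
  rw [factSum_two] at this
  linarith

theorem pirBound_lt {N : ℕ} (hN : 4 ≤ N) : pirBound N < 2 / ((N : ℝ) + 1) := by
  -- The claim amounts to N + 1 < 2N · `factSum N`, and 17/24 is the value at N = 4. At N = 3 both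
  -- sides equal 4, so the two upper bounds coincide there.
  have h : 17 / 24 ≤ factSum N := by
    have h4 : factSum 4 = 17 / 24 := by
      rw [factSum_succ (by norm_num), factSum_succ (by norm_num), factSum_two]
      norm_num [Nat.factorial]
    exact h4 ▸ factSum_mono hN
  have hN' : (4 : ℝ) ≤ N := by exact_mod_cast hN
  rw [pirBound_eq, div_lt_div_iff₀ (by positivity) (by positivity)]
  nlinarith

theorem tendsto_mul_pirBound :
    Filter.Tendsto (fun N : ℕ => (N : ℝ) * pirBound N) Filter.atTop
      (nhds (1 / (Real.exp 1 - 2))) := by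
  have he : Real.exp 1 - 2 ≠ 0 := by
    have := Real.exp_one_gt_d9
    linarith
  refine (tendsto_const_nhds.div tendsto_factSum he).congr' ?_
  filter_upwards [Filter.eventually_ge_atTop 2] with N hN
  have h1 : (N : ℝ) ≠ 0 := by positivity
  have h2 := (factSum_pos hN).ne'
  rw [pirBound_eq, Pi.div_apply]
  field_simp

theorem abs_one_div_exp_one_sub_two_sub_lt : |1 / (Real.exp 1 - 2) - 1.3922| < 0.00005 := by
  have h1 := Real.exp_one_gt_d9
  have h2 := Real.exp_one_lt_d9
  have h3 : 0 < Real.exp 1 - 2 := by linarith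
  rw [abs_lt, lt_sub_iff_add_lt, sub_lt_iff_lt_add, lt_div_iff₀ h3, div_lt_iff₀ h3]
  constructor <;> linarith

/-! ### Averaging over orderings of the servers -/

/-- Precomposing σ with the transposition of i and j preserves the initial segment up to j, so all
its members play the same role on average. -/
theorem sum_perm_image_Iic {N : ℕ} (X : Finset (Fin N) → Fin N → ℝ≥0∞) {i j : Fin N} (h : i ≤ j) :
    ∑ σ : Equiv.Perm (Fin N), X ((Finset.Iic j).image σ) (σ i) =
      ∑ σ : Equiv.Perm (Fin N), X ((Finset.Iic j).image σ) (σ j) := by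
  refine Fintype.sum_equiv (Equiv.mulRight (Equiv.swap i j)) _ _ fun σ => ?_
  have : (Finset.Iic j).image (Equiv.swap i j) = Finset.Iic j := by
    apply Finset.eq_of_subset_of_card_le
    · intro x hx
      obtain ⟨y, hy, rfl⟩ := Finset.mem_image.1 hx
      rw [Finset.mem_Iic] at hy ⊢
      rw [Equiv.swap_apply_def]
      split_ifs <;> order
    · rw [Finset.card_image_of_injective _ (Equiv.injective _)]
  simp only [Equiv.coe_mulRight, Equiv.Perm.coe_mul, Function.comp_apply, Equiv.swap_apply_right]
  rw [← Finset.image_image, this]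

/-- The transposition of k and j = k + 1 carries the segment up to k onto the segment up to j with k
removed; both have the same size and a distinguished member. -/
theorem sum_perm_image_erase {N : ℕ} (X : Finset (Fin N) → Fin N → ℝ≥0∞) {k j : Fin N}
    (h : (k : ℕ) + 1 = j) :
    ∑ σ : Equiv.Perm (Fin N), X (((Finset.Iic j).image σ).erase (σ k)) (σ j) =
      ∑ σ : Equiv.Perm (Fin N), X ((Finset.Iic k).image σ) (σ k) := by
  refine Fintype.sum_equiv (Equiv.mulRight (Equiv.swap k j)) _ _ fun σ => ?_
  have : (Finset.Iic k).image (Equiv.swap k j) = (Finset.Iic j).erase k := by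
    ext x
    simp only [Finset.mem_image, Finset.mem_Iic, Finset.mem_erase]
    constructor
    · rintro ⟨y, hy, rfl⟩
      rw [Equiv.swap_apply_def]
      split_ifs <;> constructor <;> (try rw [Fin.ext_iff] at *) <;> (try rw [Fin.le_def] at *) <;> omega
    · rintro ⟨h1, h2⟩
      refine ⟨Equiv.swap k j x, ?_, by simp⟩
      rw [Equiv.swap_apply_def]
      rw [ne_eq, Fin.ext_iff] at h1
      rw [Fin.le_def] at h2
      split_ifs with h3 h4 <;> simp only [Fin.ext_iff, Fin.le_def] at * <;> omega
  simp only [Equiv.coe_mulRight, Equiv.Perm.coe_mul, Function.comp_apply, Equiv.swap_apply_left]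
  rw [← Finset.image_image, this, Finset.image_erase σ.injective]

/-- Averaging over all orderings of the vertices. -/
theorem factSum_mul_le_sum {N : ℕ} (hN : 0 < N) (X : Finset (Fin N) → Fin N → ℝ≥0∞) (L : ℕ)
    (h : ∀ (σ : Equiv.Perm (Fin N)) (k j : Fin N), (k : ℕ) + 1 = j →
      (L : ℝ≥0∞) + X (((Finset.Iic j).image σ).erase (σ k)) (σ j) +
        ∑ i ∈ Finset.Iio j, X ((Finset.Iic i).image σ) (σ i) ≤
      ∑ i ∈ Finset.Iic j, X ((Finset.Iic j).image σ) (σ i)) :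
    ENNReal.ofReal (L * (N * factSum N)) ≤ ∑ i, X Finset.univ i := by
  set y : Fin N → ℝ≥0∞ := fun j => ∑ σ : Equiv.Perm (Fin N), X ((Finset.Iic j).image σ) (σ j)
    with hy
  set c : ℝ := N ! * L with hc
  have hc0 : 0 ≤ c := by positivity
  have hrec : ∀ k j : Fin N, (k : ℕ) + 1 = j →
      ENNReal.ofReal c + y k + ∑ i ∈ Finset.Iio j, y i ≤ ((j + 1 : ℕ) : ℝ≥0∞) * y j := by
    intro k j hkj
    have := Finset.sum_le_sum fun σ (_ : σ ∈ Finset.univ) => h σ k j hkj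
    rw [Finset.sum_add_distrib, Finset.sum_add_distrib, sum_perm_image_erase X hkj,
      Finset.sum_comm, Finset.sum_comm (t := Finset.Iic j),
      Finset.sum_congr rfl fun i hi => sum_perm_image_Iic X (Finset.mem_Iic.1 hi)] at this
    simp only [Finset.sum_const, Finset.card_univ, Fintype.card_perm, Fintype.card_fin,
      nsmul_eq_mul, Fin.card_Iic] at this
    rw [hc, ENNReal.ofReal_mul (by positivity), ENNReal.ofReal_natCast, ENNReal.ofReal_natCast]
    exact this
  -- Positions start at 0, so position m belongs to a segment of m + 1 servers. The start of the
  -- induction is trivial because `factSum 1` is 0.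
  have hlow : ∀ m (hm : m < N), ENNReal.ofReal (c * factSum (m + 1)) ≤ y ⟨m, hm⟩ := by
    intro m
    induction m using Nat.strong_induction_on with
    | _ m ih =>
      intro hm
      rcases m with _ | m
      · simp [factSum_one]
      · have h1 := hrec ⟨m, by omega⟩ ⟨m + 1, hm⟩ rfl
        have h2 : ENNReal.ofReal (∑ i ∈ Finset.range (m + 1), c * factSum (i + 1)) ≤
            ∑ i ∈ Finset.Iio (⟨m + 1, hm⟩ : Fin N), y i := by
          rw [ENNReal.ofReal_sum_of_nonneg fun i _ => mul_nonneg hc0 (factSum_nonneg _)]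
          rw [show Finset.range (m + 1) = (Finset.Iio (⟨m + 1, hm⟩ : Fin N)).map Fin.valEmbedding by
            rw [Fin.map_valEmbedding_Iio]; ext; simp, Finset.sum_map]
          refine Finset.sum_le_sum fun i hi => ih i ?_ i.2
          simpa [Fin.lt_def] using hi
        have h3 := (add_le_add (add_le_add_right (ih m (by omega) (by omega))
          (ENNReal.ofReal c)) h2).trans h1
        have hs := factSum_nonneg (m + 1)
        rw [← ENNReal.ofReal_add hc0 (by positivity), ← ENNReal.ofReal_add (by positivity)
          (Finset.sum_nonneg fun i _ => mul_nonneg hc0 (factSum_nonneg _)), ← Finset.mul_sum] at h3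
        have h4 : c + c * factSum (m + 1) + c * ∑ i ∈ Finset.range (m + 1), factSum (i + 1) =
            ((m + 1 + 1 : ℕ) : ℝ) * (c * factSum (m + 1 + 1)) := by
          have := succ_mul_factSum (m := m + 1) (by omega)
          push_cast at this ⊢
          linear_combination (-c) * this
        rw [h4, ENNReal.ofReal_mul (by positivity), ENNReal.ofReal_natCast] at h3
        exact (ENNReal.mul_le_mul_iff_right (by simp) (ENNReal.natCast_ne_top _)).1 h3
  obtain ⟨m, rfl⟩ : ∃ m, N = m + 1 := ⟨N - 1, by omega⟩
  have h1 := hlow m (by omega)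
  have huniv : Finset.Iic (⟨m, by omega⟩ : Fin (m + 1)) = Finset.univ := by
    ext i
    simp [Fin.le_def]; omega
  -- Double counting at the last position, where the segment is the whole vertex set: for fixed σ,
  -- the sum over positions is the sum over all servers.
  have h2 : ((m + 1 : ℕ) : ℝ≥0∞) * y ⟨m, by omega⟩ = ((m + 1)! : ℕ) * ∑ i, X Finset.univ i := by
    have e1 : ∀ i ∈ (Finset.univ : Finset (Fin (m + 1))),
        ∑ σ : Equiv.Perm (Fin (m + 1)), X Finset.univ (σ i) = y ⟨m, by omega⟩ := by
      intro i _
      have := sum_perm_image_Iic X (i := i) (j := ⟨m, by omega⟩) (Fin.le_def.2 (by simp; omega))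
      rw [huniv] at this
      simp only [hy, huniv]
      simpa [Finset.image_univ_equiv] using this
    have e2 := Finset.sum_congr rfl e1
    rw [Finset.sum_comm] at e2
    simp only [Equiv.sum_comp _ (X Finset.univ)] at e2
    simpa [Fintype.card_perm] using e2.symm
  have h3 := mul_le_mul_right h1 ((m + 1 : ℕ) : ℝ≥0∞)
  rw [h2, ← ENNReal.ofReal_natCast (m + 1), ← ENNReal.ofReal_mul (by positivity),
    show ((m + 1 : ℕ) : ℝ) * (c * factSum (m + 1)) =
      ((m + 1)! : ℕ) * (L * ((m + 1 : ℕ) * factSum (m + 1))) by rw [hc]; ring,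
    ENNReal.ofReal_mul (by positivity), ENNReal.ofReal_natCast] at h3
  exact (ENNReal.mul_le_mul_iff_right
    (by exact_mod_cast Nat.factorial_ne_zero _) (ENNReal.natCast_ne_top _)).1 h3

/-! ### Entropy of discrete laws with values in `[0, ∞]` -/

section DiscreteEntropy

variable {α β : Type*}

theorem PMF.tsum_map_mul (p : PMF α) (f : α → β) (g : β → ℝ≥0∞) :
    ∑' y, p.map f y * g y = ∑' x, p x * g (f x) := by
  classical
  simp only [PMF.map_apply, ← ENNReal.tsum_mul_right]
  rw [ENNReal.tsum_comm]
  refine tsum_congr fun x => ?_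
  simp only [ite_mul, zero_mul]
  exact tsum_ite_eq (f x) (fun y => p x * g y)

theorem PMF.tsum_mul_le_tsum_mul (p : PMF α) {f g : α → ℝ≥0∞} (h : ∀ x ∈ p.support, f x ≤ g x) :
    ∑' x, p x * f x ≤ ∑' x, p x * g x := by
  refine ENNReal.tsum_le_tsum fun x => ?_
  by_cases hx : p x = 0
  · simp [hx]
  · exact mul_le_mul_right (h x ((p.mem_support_iff x).2 hx)) _

/-- The joint law of a random variable with law `p` and another one with conditional laws `r`. -/
theorem PMF.bind_map_prodMk_apply (p : PMF β) (r : β → PMF α) (a : α) (y : β) :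
    (p.bind fun y => (r y).map fun a => (a, y)) (a, y) = p y * r y a := by
  classical
  have h : ∀ y', (r y').map (fun a => (a, y')) (a, y) = if y' = y then r y a else 0 := by
    intro y'
    rw [PMF.map_apply]
    split_ifs with hy
    · subst hy
      simp only [Prod.mk.injEq, and_true]
      exact (tsum_congr fun x => by simp only [eq_comm]).trans (tsum_ite_eq a fun x => r y' x)
    · simp [Ne.symm hy]
  rw [PMF.bind_apply]
  simp only [h, mul_ite, mul_zero]
  exact tsum_ite_eq y (fun y' => p y' * r y a)

theorem PMF.map_snd_bind_map_prodMk (p : PMF β) (r : β → PMF α) :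
    (p.bind fun y => (r y).map fun a => (a, y)).map Prod.snd = p := by
  rw [PMF.map_bind]
  have h : ∀ y, (r y).map (fun _ => y) = PMF.pure y := fun y => PMF.map_const _ _
  simp only [PMF.map_comp, Function.comp_def, h, PMF.bind_pure]

theorem PMF.toReal_apply_le_one (p : PMF α) (a : α) : (p a).toReal ≤ 1 :=
  ENNReal.toReal_le_of_le_ofReal zero_le_one (by simpa using p.coe_le_one a)

/-- The conditional entropy is the average of the entropies of the conditional laws. -/
theorem condEntropy_bind_map_prodMk (b : ℝ) (p : PMF β) (r : β → PMF α) :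
    condEntropy b (p.bind fun y => (r y).map fun a => (a, y)) = ∑' y, p y * entropy b (r y) := by
  unfold condEntropy entropy
  rw [PMF.map_snd_bind_map_prodMk, ENNReal.tsum_prod', ENNReal.tsum_comm]
  refine tsum_congr fun y => ?_
  rw [← ENNReal.tsum_mul_left]
  refine tsum_congr fun a => ?_
  rw [PMF.bind_map_prodMk_apply]
  by_cases hy : p y = 0
  · simp [hy]
  · have hy' : (p y).toReal ≠ 0 := ENNReal.toReal_ne_zero.2 ⟨hy, p.apply_ne_top y⟩
    rw [ENNReal.toReal_mul, mul_div_cancel_left₀ _ hy', mul_assoc, ← mul_neg,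
      ENNReal.ofReal_mul ENNReal.toReal_nonneg, ENNReal.ofReal_toReal (p.apply_ne_top y)]

/-- Conditioning does not increase the entropy. -/
theorem tsum_mul_entropy_le_entropy_bind {b : ℝ} (hb : 1 < b) (p : PMF β) (r : β → PMF α) :
    ∑' y, p y * entropy b (r y) ≤ entropy b (p.bind r) := by
  have hlog : 0 < Real.log b := Real.log_pos hb
  unfold entropy
  simp only [← ENNReal.tsum_mul_left]
  rw [ENNReal.tsum_comm]
  refine ENNReal.tsum_le_tsum fun a => ?_
  set m := p.bind r a with hm
  have hm_eq : m = ∑' y, p y * r y a := PMF.bind_apply _ _ _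
  have hm_top : m ≠ ∞ := PMF.apply_ne_top _ _
  by_cases hm0 : m = 0
  · have h0 : ∀ y, p y * r y a = 0 := ENNReal.tsum_eq_zero.1 (hm_eq ▸ hm0)
    refine le_of_eq_of_le (ENNReal.tsum_eq_zero.2 fun y => ?_) zero_le
    rcases mul_eq_zero.1 (h0 y) with h | h <;> simp [h]
  have hmpos : 0 < m.toReal := ENNReal.toReal_pos hm0 hm_top
  have hm1 : m.toReal ≤ 1 := PMF.toReal_apply_le_one _ _
  set c : ℝ := 1 / Real.log b with hc
  have hcpos : 0 < c := by positivity
  have hl : 0 ≤ -Real.logb b m.toReal := neg_nonneg.2 (Real.logb_nonpos hb hmpos.le hm1)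
  -- The tangent line at m to the concave function -x log x. The linear terms are distributed over
  -- both sides to avoid subtraction in `ℝ≥0∞`; averaged over y, each becomes the same finite
  -- quantity m · c and cancels.
  have hpt : ∀ y, ENNReal.ofReal (-((r y a).toReal * Real.logb b (r y a).toReal)) +
      r y a * ENNReal.ofReal c ≤
      r y a * ENNReal.ofReal (-Real.logb b m.toReal) + m * ENNReal.ofReal c := by
    intro y
    have hr1 : (r y a).toReal ≤ 1 := PMF.toReal_apply_le_one _ _
    have hr0 : 0 ≤ (r y a).toReal := ENNReal.toReal_nonneg
    have hrt : r y a ≠ ∞ := PMF.apply_ne_top _ _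
    conv_lhs => rw [← ENNReal.ofReal_toReal hrt]
    conv_rhs => rw [← ENNReal.ofReal_toReal hrt, ← ENNReal.ofReal_toReal hm_top]
    rw [ENNReal.toReal_ofReal hr0, ENNReal.toReal_ofReal hmpos.le, ← ENNReal.ofReal_mul hr0,
      ← ENNReal.ofReal_mul hr0, ← ENNReal.ofReal_mul hmpos.le,
      ← ENNReal.ofReal_add _ (by positivity), ← ENNReal.ofReal_add (by positivity) (by positivity)]
    · apply ENNReal.ofReal_le_ofReal
      rcases hr0.eq_or_lt with h | h
      · simp only [← h]
        have : 0 ≤ m.toReal * c := by positivity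
        simpa using this
      · have h1 := Real.log_le_sub_one_of_pos (div_pos hmpos h)
        rw [Real.log_div hmpos.ne' h.ne'] at h1
        have h2 : (r y a).toReal * (Real.log m.toReal - Real.log (r y a).toReal) ≤
            m.toReal - (r y a).toReal := by
          calc _ ≤ (r y a).toReal * (m.toReal / (r y a).toReal - 1) := by gcongr
            _ = _ := by field_simp
        have h3 := mul_le_mul_of_nonneg_right h2 hcpos.le
        rw [Real.logb, Real.logb, div_eq_mul_one_div (Real.log m.toReal),
          div_eq_mul_one_div (Real.log (r y a).toReal), ← hc]
        linarith
    · exact neg_nonneg.2 (mul_nonpos_of_nonneg_of_nonpos hr0 (Real.logb_nonpos hb hr0 hr1))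
  have hsum := ENNReal.tsum_le_tsum fun y => mul_le_mul_right (hpt y) (p y)
  simp only [mul_add, ENNReal.tsum_add, ← mul_assoc, ENNReal.tsum_mul_right, ← hm_eq,
    p.tsum_coe, one_mul] at hsum
  have hfin : m * ENNReal.ofReal c ≠ ∞ := ENNReal.mul_ne_top hm_top ENNReal.ofReal_ne_top
  refine (ENNReal.le_of_add_le_add_right hfin hsum).trans (le_of_eq ?_)
  rw [← mul_neg, ENNReal.ofReal_mul hmpos.le, ENNReal.ofReal_toReal hm_top]

/-- If the conditional entropy vanishes, the second variable determines the first. -/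
theorem eq_of_condEntropy_eq_zero {b : ℝ} (hb : 1 < b) {p : PMF (α × β)}
    (h : condEntropy b p = 0) {x x' : α} {y : β} (hx : (x, y) ∈ p.support)
    (hx' : (x', y) ∈ p.support) : x = x' := by
  classical
  by_contra hne
  rw [PMF.mem_support_iff] at hx hx'
  have h1 := ENNReal.tsum_eq_zero.1 h (x, y)
  rw [ENNReal.ofReal_eq_zero, neg_nonpos] at h1
  have hpos : 0 < (p (x, y)).toReal := ENNReal.toReal_pos hx (p.apply_ne_top _)
  have hpos' : 0 < (p (x', y)).toReal := ENNReal.toReal_pos hx' (p.apply_ne_top _)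
  -- Two distinct values over the same y force a conditional probability strictly below 1, hence a
  -- strictly positive term in the entropy.
  have h2 : p (x, y) + p (x', y) ≤ p.map Prod.snd y := by
    rw [PMF.map_apply]
    refine le_trans (le_of_eq ?_) (ENNReal.sum_le_tsum {(x, y), (x', y)})
    rw [Finset.sum_pair (by simpa using hne)]
    simp
  have h3 : (p (x, y)).toReal + (p (x', y)).toReal ≤ (p.map Prod.snd y).toReal := by
    rw [← ENNReal.toReal_add (p.apply_ne_top _) (p.apply_ne_top _)]
    exact ENNReal.toReal_mono (PMF.apply_ne_top _ _) h2
  have h4 : (p (x, y)).toReal / (p.map Prod.snd y).toReal < 1 := by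
    rw [div_lt_one (by linarith)]
    linarith
  have h5 := Real.logb_neg hb (div_pos hpos (by linarith)) h4
  exact absurd h1 (not_le.2 (mul_neg_of_pos_of_neg hpos h5))

end DiscreteEntropy

/-! ### Entropy inequalities for answers on a graph -/

section Graph

variable {V : Type*} {G : SimpleGraph V}

/-- The edges that do not lie inside `U`. -/
def edgesOutside (G : SimpleGraph V) (U : Finset V) : Set G.edgeSet :=
  {e | ∃ v ∈ (e : Sym2 V), v ∉ U}

theorem edgesOutside_anti {U U' : Finset V} (h : U ⊆ U') :
    edgesOutside G U' ⊆ edgesOutside G U :=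
  fun _ ⟨v, hv, hvU⟩ => ⟨v, hv, fun hh => hvU (h hh)⟩

theorem incident_subset_edgesOutside {U : Finset V} {a : V} (h : a ∉ U) :
    {e : G.edgeSet | a ∈ (e : Sym2 V)} ⊆ edgesOutside G U :=
  fun _ he => ⟨a, he, h⟩

variable {α : Type*} [Fintype (G.edgeSet → α)] {b : ℝ} {s : V → Setoid (G.edgeSet → α)}

/-- Chain rule, revealing the answer of a first. All files on a lie outside U, so the files outside
U determine that answer; conditioning on them instead can only lower the remaining term. -/
theorem partitionCondEntropy_insert [DecidableEq V] (hb : 1 < b)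
    (hs : ∀ i, agreeOn {e : G.edgeSet | i ∈ (e : Sym2 V)} ≤ s i) {U : Finset V} {a : V}
    (ha : a ∉ U) :
    partitionCondEntropy b (s a) (agreeOn (edgesOutside G (insert a U))) +
      partitionCondEntropy b (U.inf s) (agreeOn (edgesOutside G U)) ≤
    partitionCondEntropy b ((insert a U).inf s) (agreeOn (edgesOutside G (insert a U))) := by
  rw [Finset.inf_insert, partitionCondEntropy_chain]
  gcongr
  refine partitionCondEntropy_anti_right hb _ (le_inf ?_ ?_)
  · exact (agreeOn_anti (incident_subset_edgesOutside ha)).trans (hs a)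
  · exact agreeOn_anti (edgesOutside_anti (Finset.subset_insert a U))

/-- Iterates the removal of the last server of the ordering. The server σ i is removed from the
segment ending in i, which explains `Iic i` in the conditioning. -/
theorem sum_partitionCondEntropy_le [DecidableEq V] (hb : 1 < b)
    (hs : ∀ i, agreeOn {e : G.edgeSet | i ∈ (e : Sym2 V)} ≤ s i) {N : ℕ} (σ : Fin N ↪ V)
    (j : Fin N) :
    ∑ i ∈ Finset.Iio j, partitionCondEntropy b (s (σ i))
        (agreeOn (edgesOutside G ((Finset.Iic i).image σ))) ≤
      partitionCondEntropy b (((Finset.Iio j).image σ).inf s)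
        (agreeOn (edgesOutside G ((Finset.Iio j).image σ))) := by
  obtain ⟨m, hm⟩ := j
  induction m with
  | zero =>
    have : Finset.Iio (⟨0, hm⟩ : Fin N) = ∅ := by
      ext i; simp [Fin.lt_def]
    simp [this, partitionCondEntropy]
  | succ m ih =>
    have h1 : Finset.Iio (⟨m + 1, hm⟩ : Fin N) = Finset.Iic ⟨m, by omega⟩ := by
      ext i; simp [Fin.lt_def, Fin.le_def]
    have h2 : Finset.Iic (⟨m, by omega⟩ : Fin N) = insert ⟨m, by omega⟩ (Finset.Iio ⟨m, by omega⟩) :=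
      (Finset.Iio_insert _).symm
    rw [h1]
    nth_rewrite 1 [h2]
    rw [Finset.sum_insert (by simp)]
    have h3 := partitionCondEntropy_insert hb hs (U := (Finset.Iio ⟨m, by omega⟩).image σ)
      (a := σ ⟨m, by omega⟩) (by simp)
    rw [← Finset.image_insert, ← h2] at h3
    exact (add_le_add_right (ih (by omega)) _).trans h3

/-- The core inequality, for fixed queries. The entropy of the answers from U splits into the file θ
= ac, then the answer of a, then the other answers. Each of the last two is bounded below by
revealing all files of one endpoint of θ: those of c for the answer of a, those of a for the others.
-/
theorem add_partitionCondEntropy_le_sum [DecidableEq V] [Fintype V] [Fintype α] [Nonempty α]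
    (hb : 1 < b)
    (hs : ∀ i, agreeOn {e : G.edgeSet | i ∈ (e : Sym2 V)} ≤ s i) {U : Finset V} {a c : V}
    (ha : a ∈ U) (hc : c ∈ U) (θ : G.edgeSet) (hθ : (θ : Sym2 V) = s(a, c))
    (hdec : Finset.univ.inf s ≤ agreeOn {θ}) :
    Real.logb b (Fintype.card α) +
      partitionCondEntropy b (s a) (agreeOn (edgesOutside G (U.erase c))) +
      partitionCondEntropy b ((U.erase a).inf s) (agreeOn (edgesOutside G (U.erase a))) ≤
    ∑ i ∈ U, partitionCondEntropy b (s i) (agreeOn (edgesOutside G U)) := by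
  have hθU : θ ∉ edgesOutside G U := by
    rintro ⟨v, hv, hvU⟩
    rw [hθ, Sym2.mem_iff] at hv
    rcases hv with rfl | rfl <;> contradiction
  -- Servers not in U store only files outside U, so their answers are already known and reliability
  -- needs only the answers from U.
  have hUinf : U.inf s ⊓ agreeOn (edgesOutside G U) ≤ agreeOn {θ} := by
    refine le_trans (Finset.le_inf fun i _ => ?_) hdec
    by_cases hi : i ∈ U
    · exact inf_le_left.trans (Finset.inf_le hi)
    · exact inf_le_right.trans ((agreeOn_anti (incident_subset_edgesOutside hi)).trans (hs i))
  -- Once an endpoint of θ leaves U, the file θ itself counts as outside.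
  have hmem : ∀ v ∈ (θ : Sym2 V), agreeOn (edgesOutside G (U.erase v)) ≤
      (agreeOn {θ} ⊓ agreeOn (edgesOutside G U) : Setoid (G.edgeSet → α)) := by
    intro v hv
    refine le_inf (agreeOn_anti ?_) (agreeOn_anti (edgesOutside_anti (Finset.erase_subset v U)))
    rw [Set.singleton_subset_iff]
    exact ⟨v, hv, Finset.notMem_erase v U⟩
  have h1 := partitionCondEntropy_finset_inf_le hb U s (agreeOn (edgesOutside G U))
  have h2 := partitionCondEntropy_chain b (agreeOn {θ}) (U.inf s) (agreeOn (edgesOutside G U))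
  have h3 : partitionCondEntropy b (agreeOn {θ} ⊓ U.inf s) (agreeOn (edgesOutside G U)) =
      partitionCondEntropy b (U.inf s) (agreeOn (edgesOutside G U)) := by
    unfold partitionCondEntropy
    rw [inf_assoc, inf_eq_right.2 hUinf]
  have h4 := logb_card_le_partitionCondEntropy (α := α) hb hθU
  have h5 := partitionCondEntropy_chain b (s a) ((U.erase a).inf s)
    (agreeOn {θ} ⊓ agreeOn (edgesOutside G U))
  rw [← Finset.inf_insert, Finset.insert_erase ha] at h5
  have h6 := partitionCondEntropy_anti_right hb (s a) (hmem c (by simp [hθ]))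
  -- The files outside `U.erase a` include θ and all files on a, so they determine the answer of a
  -- as well.
  have h7 := partitionCondEntropy_anti_right hb ((U.erase a).inf s)
    (le_inf ((agreeOn_anti (incident_subset_edgesOutside (Finset.notMem_erase a U))).trans (hs a))
      (hmem a (by simp [hθ])))
  linarith

end Graph

/-! ### From PIR schemes to partitions of the file space -/

namespace PIRScheme

section

variable {V : Type*} [Finite V] {G : SimpleGraph V} (S : PIRScheme G)

noncomputable instance : Fintype S.Files := Fintype.ofFinite _

theorem one_lt_base {V : Type*} {G : SimpleGraph V} (S : PIRScheme G) : 1 < S.base := by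
  unfold base
  exact_mod_cast Fintype.one_lt_card

theorem logb_base_card {V : Type*} {G : SimpleGraph V} (S : PIRScheme G) : Real.logb S.base (Fintype.card (Fin S.L → S.F)) = S.L := by
  have h := S.one_lt_base
  rw [Fintype.card_fun, Fintype.card_fin]
  push_cast
  change Real.logb S.base (S.base ^ S.L) = S.L
  rw [Real.logb_pow, Real.logb_self_eq_one h, mul_one]

theorem filesLaw_eq : S.filesLaw = PMF.uniformOfFintype S.Files := rfl

/-- The answer of server `i` to the query `x`, as a function of all files. -/
def answerOf {V : Type*} {G : SimpleGraph V} (S : PIRScheme G) (i : V) (x : S.Query i)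
    (w : S.Files) : S.Answer i :=
  S.answer i x fun e => w e.1

theorem agreeOn_incident_le_ker_answerOf {V : Type*} {G : SimpleGraph V} (S : PIRScheme G) (i : V)
    (x : S.Query i) :
    agreeOn {e : G.edgeSet | i ∈ (e : Sym2 V)} ≤ Setoid.ker (S.answerOf i x) := by
  intro w w' h
  rw [Setoid.ker_def]
  exact congrArg (S.answer i x) (funext fun e => h e.1 e.2)

/-- The conditional entropy of the answer of server `i` given its query and the files that are not
stored inside `U`, when the desired file is `θ`. -/
noncomputable def answerEntropy (θ : G.edgeSet) (U : Finset V) (i : V) : ℝ≥0∞ :=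
  ∑' x, (S.query θ).map (fun q => q i) x * ENNReal.ofReal
    (partitionCondEntropy S.base (Setoid.ker (S.answerOf i x)) (agreeOn (edgesOutside G U)))

theorem answerEntropy_eq_tsum (θ : G.edgeSet) (U : Finset V) (i : V) :
    S.answerEntropy θ U i = ∑' q, S.query θ q * ENNReal.ofReal
      (partitionCondEntropy S.base (Setoid.ker (S.answerOf i (q i)))
        (agreeOn (edgesOutside G U))) :=
  PMF.tsum_map_mul _ _ fun x => ENNReal.ofReal
    (partitionCondEntropy S.base (Setoid.ker (S.answerOf i x)) (agreeOn (edgesOutside G U)))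

theorem map_query_eq (θ : G.edgeSet) (i : V) :
    (S.law θ).map (fun ω => ω.1 i) = (S.query θ).map fun q => q i := by
  have h : ∀ x : S.Query i, S.filesLaw.map (fun _ => x) = PMF.pure x := fun x => PMF.map_const _ _
  unfold law
  rw [PMF.map_bind]
  simp only [PMF.map_comp, Function.comp_def, h]
  exact PMF.bind_pure_comp _ _

/-- Only the query marginal of the privacy condition enters, since queries are independent of files
and answers are deterministic functions of both. -/
theorem IsPrivate.answerEntropy_eq {S : PIRScheme G} (h : S.IsPrivate) (θ θ' : G.edgeSet)
    (U : Finset V) (i : V) : S.answerEntropy θ U i = S.answerEntropy θ' U i := by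
  have := congrArg (PMF.map fun x => x.1) (h i θ θ')
  simp only [PMF.map_comp, Function.comp_def, map_query_eq] at this
  simp only [answerEntropy, this]

theorem law_map_ans_query (θ : G.edgeSet) (i : V) :
    (S.law θ).map (fun ω => (S.ans i ω, ω.1 i)) =
      ((S.query θ).map fun q => q i).bind fun x =>
        ((PMF.uniformOfFintype S.Files).map (S.answerOf i x)).map fun a => (a, x) := by
  unfold law
  rw [PMF.map_bind, PMF.bind_map]
  simp only [PMF.map_comp]
  rfl

theorem entropy_map_answerOf (i : V) (x : S.Query i) :
    entropy S.base ((PMF.uniformOfFintype S.Files).map (S.answerOf i x)) =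
      ENNReal.ofReal (partitionEntropy S.base (Setoid.ker (S.answerOf i x))) :=
  entropy_map_uniformOfFintype S.one_lt_base _

theorem condEntropy_ans_query [Fintype V] (θ : G.edgeSet) (i : V) :
    condEntropy S.base ((S.law θ).map fun ω => (S.ans i ω, ω.1 i)) =
      S.answerEntropy θ Finset.univ i := by
  -- For the full vertex set no file is revealed, so the conditioning on files is trivial.
  have hout : edgesOutside G (Finset.univ : Finset V) = ∅ := by
    ext e
    simp [edgesOutside]
  rw [law_map_ans_query, condEntropy_bind_map_prodMk]
  unfold answerEntropy
  simp only [entropy_map_answerOf, hout, agreeOn_empty, partitionCondEntropy, inf_top_eq,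
    partitionEntropy_top, sub_zero]

theorem condEntropy_le_entropy_ans (θ : G.edgeSet) (i : V) :
    condEntropy S.base ((S.law θ).map fun ω => (S.ans i ω, ω.1 i)) ≤
      entropy S.base ((S.law θ).map (S.ans i)) := by
  have h : (S.law θ).map (S.ans i) = ((S.query θ).map fun q => q i).bind fun x =>
      (PMF.uniformOfFintype S.Files).map (S.answerOf i x) := by
    have := congrArg (PMF.map Prod.fst) (S.law_map_ans_query θ i)
    have hid : ∀ x : S.Query i, ((PMF.uniformOfFintype S.Files).map (S.answerOf i x)).map
        (fun a => a) = (PMF.uniformOfFintype S.Files).map (S.answerOf i x) :=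
      fun x => PMF.map_id _
    rw [PMF.map_comp, PMF.map_bind] at this
    simp only [PMF.map_comp _ _ Prod.fst, Function.comp_def Prod.fst, hid] at this
    exact this
  rw [law_map_ans_query, condEntropy_bind_map_prodMk, h]
  exact tsum_mul_entropy_le_entropy_bind S.one_lt_base _ _

theorem mem_support_law {θ : G.edgeSet} {q : ∀ i, S.Query i} (hq : q ∈ (S.query θ).support)
    (w : S.Files) : (q, w) ∈ (S.law θ).support := by
  unfold law
  rw [PMF.mem_support_bind_iff]
  refine ⟨q, hq, ?_⟩
  rw [PMF.mem_support_map_iff]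
  exact ⟨w, by rw [filesLaw_eq]; exact PMF.mem_support_uniformOfFintype w, rfl⟩

/-- The answers determine the desired file, for all possible queries. -/
theorem IsReliable.inf_ker_le [Fintype V] {S : PIRScheme G} (h : S.IsReliable) {θ : G.edgeSet}
    {q : ∀ i, S.Query i} (hq : q ∈ (S.query θ).support) :
    (Finset.univ.inf fun i => Setoid.ker (S.answerOf i (q i))) ≤ agreeOn {θ} := by
  intro w w' hw e he
  rw [Set.mem_singleton_iff] at he
  subst he
  have hans : ∀ i, S.answerOf i (q i) w = S.answerOf i (q i) w' := fun i =>
    Finset.inf_le (f := fun i => Setoid.ker (S.answerOf i (q i))) (Finset.mem_univ i) hw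
  have key : ∀ w : S.Files, (w e, ((fun i => S.answerOf i (q i) w), q)) ∈
      ((S.law e).map fun ω => (ω.2 e, ((fun i => S.ans i ω), ω.1))).support := by
    intro w
    rw [PMF.mem_support_map_iff]
    exact ⟨(q, w), S.mem_support_law hq w, rfl⟩
  have h1 := key w
  rw [show (fun i => S.answerOf i (q i) w) = fun i => S.answerOf i (q i) w' from
    funext hans] at h1
  exact eq_of_condEntropy_eq_zero S.one_lt_base (h e) h1 (key w')

/-- The averaged form of the bound for an edge `{σ k, σ j}` and an ordering `σ` of servers. -/
theorem IsReliable.add_answerEntropy_le [Fintype V] [DecidableEq V] {S : PIRScheme G}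
    (h : S.IsReliable) {N : ℕ}
    (σ : Fin N ↪ V) {k j : Fin N} (hkj : (k : ℕ) + 1 = j) (θ : G.edgeSet)
    (hθ : (θ : Sym2 V) = s(σ j, σ k)) :
    (S.L : ℝ≥0∞) + S.answerEntropy θ (((Finset.Iic j).image σ).erase (σ k)) (σ j) +
        ∑ i ∈ Finset.Iio j, S.answerEntropy θ ((Finset.Iic i).image σ) (σ i) ≤
      ∑ i ∈ Finset.Iic j, S.answerEntropy θ ((Finset.Iic j).image σ) (σ i) := by
  have hb := S.one_lt_base
  have hker : k < j := Fin.lt_def.2 (by omega)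
  have hL : (S.L : ℝ≥0∞) = ∑' q, S.query θ q * ENNReal.ofReal (S.L : ℝ) := by
    rw [ENNReal.tsum_mul_right, PMF.tsum_coe, one_mul, ENNReal.ofReal_natCast]
  simp only [answerEntropy_eq_tsum]
  rw [hL, ← ENNReal.tsum_add,
    ← Summable.tsum_finsetSum (fun _ _ => ENNReal.summable),
    ← Summable.tsum_finsetSum (fun _ _ => ENNReal.summable), ← ENNReal.tsum_add]
  simp only [← Finset.mul_sum, ← mul_add]
  -- The inequality is proved for each query tuple separately; only tuples of positive probability
  -- matter, and reliability guarantees decoding only for these.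
  refine PMF.tsum_mul_le_tsum_mul _ fun q hq => ?_
  have hs : ∀ i, agreeOn {e : G.edgeSet | i ∈ (e : Sym2 V)} ≤ Setoid.ker (S.answerOf i (q i)) :=
    fun i => S.agreeOn_incident_le_ker_answerOf i (q i)
  have h1 := add_partitionCondEntropy_le_sum hb hs (U := (Finset.Iic j).image σ) (a := σ j)
    (c := σ k) (Finset.mem_image_of_mem _ (by simp)) (Finset.mem_image_of_mem _ (by simp [hker.le]))
    θ hθ (h.inf_ker_le hq)
  rw [S.logb_base_card, Finset.sum_image σ.injective.injOn] at h1
  have h2 := sum_partitionCondEntropy_le hb hs σ j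
  have herase : ((Finset.Iic j).image σ).erase (σ j) = (Finset.Iio j).image σ := by
    rw [← Finset.image_erase σ.injective, Finset.Iic_erase]
  rw [herase] at h1
  have hnn := fun i U => partitionCondEntropy_nonneg hb (Setoid.ker (S.answerOf i (q i)))
    (agreeOn (edgesOutside G U))
  rw [← ENNReal.ofReal_sum_of_nonneg fun i _ => hnn _ _,
    ← ENNReal.ofReal_sum_of_nonneg fun i _ => hnn _ _,
    ← ENNReal.ofReal_add (Nat.cast_nonneg _) (hnn _ _),
    ← ENNReal.ofReal_add (add_nonneg (Nat.cast_nonneg _) (hnn _ _))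
      (Finset.sum_nonneg fun i _ => hnn _ _)]
  apply ENNReal.ofReal_le_ofReal
  linarith

end

theorem IsValid.le_sum_condEntropy {N : ℕ} {S : PIRScheme (⊤ : SimpleGraph (Fin N))}
    (h : S.IsValid) (θ : (⊤ : SimpleGraph (Fin N)).edgeSet) :
    ENNReal.ofReal (S.L * (N * factSum N)) ≤
      ∑ i, condEntropy S.base ((S.law θ).map fun ω => (S.ans i ω, ω.1 i)) := by
  simp only [condEntropy_ans_query]
  rcases N.eq_zero_or_pos with rfl | hN
  · simp
  refine factSum_mul_le_sum hN (S.answerEntropy θ) S.L fun σ k j hkj => ?_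
  have hne : σ j ≠ σ k := fun hh => by
    have := σ.injective hh
    omega
  -- The desired file here varies with σ and j; completeness of the graph makes it available, and
  -- privacy then replaces it by the fixed θ in every term.
  have := h.1.add_answerEntropy_le σ.toEmbedding hkj
    ⟨s(σ j, σ k), by simpa using hne⟩ rfl
  simpa only [h.2.answerEntropy_eq _ θ, Equiv.coe_toEmbedding] using this

theorem natCast_div_le_ofReal_pirBound {N L : ℕ} (hN : 2 ≤ N) (hL : 0 < L) {D : ℝ≥0∞}
    (h : ENNReal.ofReal (L * (N * factSum N)) ≤ D) :
    (L : ℝ≥0∞) / D ≤ ENNReal.ofReal (pirBound N) := by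
  have h1 := factSum_pos hN
  have hN' : (0 : ℝ) < N := by positivity
  have hL' : (0 : ℝ) < L := by positivity
  refine (ENNReal.div_le_div_left h _).trans (le_of_eq ?_)
  rw [← ENNReal.ofReal_natCast, ← ENNReal.ofReal_div_of_pos (by positivity), pirBound_eq]
  congr 1
  field_simp

end PIRScheme

/-! ### Capacity bounds and the main theorem -/

theorem pirCondCapacity_le {N : ℕ} (hN : 2 ≤ N) :
    pirCondCapacity (⊤ : SimpleGraph (Fin N)) ≤ ENNReal.ofReal (pirBound N) := by
  refine iSup_le fun S => iSup_le fun hS => iSup_le fun θ => ?_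
  unfold PIRScheme.condRate
  rw [tsum_fintype]
  exact PIRScheme.natCast_div_le_ofReal_pirBound hN S.L_pos (hS.le_sum_condEntropy θ)

theorem pirCapacity_le {N : ℕ} (hN : 2 ≤ N) :
    pirCapacity (⊤ : SimpleGraph (Fin N)) ≤ ENNReal.ofReal (pirBound N) := by
  refine iSup_le fun S => iSup_le fun hS => iSup_le fun θ => ?_
  unfold PIRScheme.rate
  rw [tsum_fintype]
  exact PIRScheme.natCast_div_le_ofReal_pirBound hN S.L_pos ((hS.le_sum_condEntropy θ).trans
    (Finset.sum_le_sum fun i _ => S.condEntropy_le_entropy_ans θ i))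

theorem mainTheorem1 :
    (∀ N : ℕ, 3 ≤ N →
      pirCapacity (⊤ : SimpleGraph (Fin N)) ≤ ENNReal.ofReal (pirBound N) ∧
      pirCondCapacity (⊤ : SimpleGraph (Fin N)) ≤ ENNReal.ofReal (pirBound N)) ∧
    (∀ N : ℕ, 4 ≤ N →
      pirCapacity (⊤ : SimpleGraph (Fin N)) < ENNReal.ofReal (2 / ((N : ℝ) + 1))) ∧
    Filter.Tendsto (fun N : ℕ => (N : ℝ) * pirBound N) Filter.atTop
      (nhds (1 / (Real.exp 1 - 2))) ∧
    Filter.limsup (fun N : ℕ => (N : ℝ≥0∞) * pirCapacity (⊤ : SimpleGraph (Fin N)))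
      Filter.atTop ≤ ENNReal.ofReal (1 / (Real.exp 1 - 2)) ∧
    |1 / (Real.exp 1 - 2) - 1.3922| < 0.00005 := by
  refine ⟨fun N hN => ⟨pirCapacity_le (by omega), pirCondCapacity_le (by omega)⟩, fun N hN => ?_,
    tendsto_mul_pirBound, ?_, abs_one_div_exp_one_sub_two_sub_lt⟩
  · exact (pirCapacity_le (by omega)).trans_lt
      ((ENNReal.ofReal_lt_ofReal_iff (by positivity)).2 (pirBound_lt hN))
  · have h1 : Filter.Tendsto (fun N : ℕ => ENNReal.ofReal ((N : ℝ) * pirBound N)) Filter.atTop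
        (nhds (ENNReal.ofReal (1 / (Real.exp 1 - 2)))) :=
      ENNReal.tendsto_ofReal tendsto_mul_pirBound
    rw [← h1.limsup_eq]
    refine Filter.limsup_le_limsup ?_
    filter_upwards [Filter.eventually_ge_atTop 2] with N hN
    rw [ENNReal.ofReal_mul (Nat.cast_nonneg _), ENNReal.ofReal_natCast]
    exact mul_le_mul_right (pirCapacity_le hN) _
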